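/- A call center has two levels, with $C_1^N=N$ servers at level 1 and $C_2^N$ servers at level 2, where $C_2^N/N\to r$ as $N\to\infty$ for some $r>0$. Let $p\in[0,1]$ and $\mu_{01},\mu_{11},\mu_{02}>0$. For each $N$ let $X^N(t)=(Y_*^N(t),Y^N(t),Z^N(t))$, $t\ge 0$, be a right-continuous Markov jump process on $$\mathcal S_N=\{(y_*,y,z)\in\mathbb N^3:\ y+y_*\le N,\ z\le C_2^N,\ y_*z=0\}$$ with transition rates from $x=(y_*,y,z)$ given by $$\begin{aligned} (y_*+1,y-1,0)&:\ \mu_{01}\,y\,1_{\{z=0\}}, &(0,y-1,z-1)&:\ \mu_{01}\,y(1-p)\,1_{\{z>0\}},\\ (0,y,z-1)&:\ \mu_{01}\,y\,p\,1_{\{z>0\}}, &(y_*,y+1,z)&:\ \mu_{11}\,p\,(N-y_*-y),\\ (y_*-1,y,z)&:\ (1-p)\mu_{02}C_2^N\,1_{\{y_*>0\}}, &(y_*-1,y+1,z)&:\ p\,\mu_{02}C_2^N\,1_{\{y_*>0\}},\\ (0,y,z+1)&:\ \mu_{02}(C_2^N-z)\,1_{\{y_*=0\}}. \end{aligned}$$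 (Here $Y_*^N$ is the number of urgent jobs blocked at level 1, $Y^N$ the number of urgent jobs in service at level 1, and $Z^N$ the number of idle servers at level 2.) Let $$r_c=\frac{p}{\mu_{02}}\Big/\Big(\frac{p}{\mu_{01}}+\frac{1-p}{\mu_{11}}\Big)$$ and assume that $r<r_c$ (the overloaded regime). Then there exists $t_1>0$ such that, for every initial fluid state $x_0\in[0,1]^2\times[0,r]$ and every sequence of such processes whose initial states satisfy $\frac1N X^N(0)\to x_0$ in probability (in particular, deterministic initial states with $\frac1N X^N(0)\to x_0$), and for every $T\ge t_1$, $$\lim_{N\to\infty}\mathbb P\big(Z^N(t)=0\ \text{ for all } t\in[t_1,T]\big)=1 .$$ That is, level 2 stays fully busy after a fixed time $t_1$ that does not depend on the initial state nor on $T$. -/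

import Mathlib

open MeasureTheory Filter Topology
open scoped NNReal

namespace CallCenter

noncomputable section

/-- The state space `S_N` for capacities `C₁` and `C₂`: `ys` is the number of class `0` jobs blocked
at level 1, `y` the number of class `0` jobs being served at level 1, and `z` the number of idle
servers at level 2. -/
@[ext]
structure State (C₁ C₂ : ℕ) where
  ys : ℕ
  y : ℕ
  z : ℕ
  level_one_le : y + ys ≤ C₁
  idle_le : z ≤ C₂
  blocked_mul_idle : ys * z = 0
deriving DecidableEq

instance State.instFintype (C₁ C₂ : ℕ) : Fintype (State C₁ C₂) :=
  Fintype.ofInjective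
    (fun x : State C₁ C₂ =>
      ((⟨x.ys, by have := x.level_one_le; omega⟩, ⟨x.y, by have := x.level_one_le; omega⟩,
        ⟨x.z, by have := x.idle_le; omega⟩) : Fin (C₁ + 1) × Fin (C₁ + 1) × Fin (C₂ + 1)))
    (by
      intro a b h
      simp only [Prod.mk.injEq, Fin.mk.injEq] at h
      exact State.ext h.1 h.2.1 h.2.2)

/-- The transition rate from `x` to `x'`. The seven summands are the seven possible jumps. A jump
`v ↦ v - 1` of a coordinate is written `v' + 1 = v`. -/
def rate (p μ₀₁ μ₁₁ μ₀₂ : ℝ) {C₁ C₂ : ℕ} (x x' : State C₁ C₂) : ℝ :=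
  (if x.z = 0 ∧ x'.ys = x.ys + 1 ∧ x'.y + 1 = x.y ∧ x'.z = 0
    then μ₀₁ * x.y else 0)
  + (if 0 < x.z ∧ x'.ys = 0 ∧ x'.y + 1 = x.y ∧ x'.z + 1 = x.z
    then μ₀₁ * x.y * (1 - p) else 0)
  + (if 0 < x.z ∧ x'.ys = 0 ∧ x'.y = x.y ∧ x'.z + 1 = x.z
    then μ₀₁ * x.y * p else 0)
  + (if x'.ys = x.ys ∧ x'.y = x.y + 1 ∧ x'.z = x.z
    then μ₁₁ * p * ((C₁ : ℝ) - x.ys - x.y) else 0)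
  + (if 0 < x.ys ∧ x'.ys + 1 = x.ys ∧ x'.y = x.y ∧ x'.z = x.z
    then (1 - p) * μ₀₂ * C₂ else 0)
  + (if 0 < x.ys ∧ x'.ys + 1 = x.ys ∧ x'.y = x.y + 1 ∧ x'.z = x.z
    then p * μ₀₂ * C₂ else 0)
  + (if x.ys = 0 ∧ x'.ys = 0 ∧ x'.y = x.y ∧ x'.z = x.z + 1
    then μ₀₂ * ((C₂ : ℝ) - x.z) else 0)

/-- The `Q`-matrix of the transition rates: off the diagonal the rates, on the diagonal minus the
total rate out of the state. -/
def generator (p μ₀₁ μ₁₁ μ₀₂ : ℝ) (C₁ C₂ : ℕ) :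
    Matrix (State C₁ C₂) (State C₁ C₂) ℝ :=
  fun x x' =>
    if x = x' then -∑ x'' ∈ Finset.univ.erase x, rate p μ₀₁ μ₁₁ μ₀₂ x x''
    else rate p μ₀₁ μ₁₁ μ₀₂ x x'

/-- `X` is, under `P`, a (right-continuous) Markov jump process on the finite set `S` with
`Q`-matrix `Q`: given its values at times `t 0 ≤ ⋯ ≤ t n`, it is at time `t (n + 1)` distributed
according to row `X (t n)` of the transition matrix `exp ((t (n + 1) - t n) Q)`. The initial law is
arbitrary. -/
structure IsMarkovJumpProcess {S : Type*} [Fintype S] [DecidableEq S] (Q : Matrix S S ℝ)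
    {Ω : Type*} [MeasurableSpace Ω] (P : Measure Ω) (X : ℝ≥0 → Ω → S) : Prop where
  measurableSet_eq : ∀ (t : ℝ≥0) (x : S), MeasurableSet {ω | X t ω = x}
  right_continuous : ∀ (ω : Ω) (t : ℝ≥0), ∀ᶠ s in 𝓝[>] t, X s ω = X t ω
  markov : ∀ (n : ℕ) (t : ℕ → ℝ≥0) (x : ℕ → S), Monotone t →
    P.real {ω | ∀ i ≤ n + 1, X (t i) ω = x i} =
      P.real {ω | ∀ i ≤ n, X (t i) ω = x i} *
        (NormedSpace.exp (((t (n + 1) : ℝ) - (t n : ℝ)) • Q)) (x n) (x (n + 1))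

/-- The state `(ys, y, z)` divided by the scaling parameter `N`. -/
def State.scaled {C₁ C₂ : ℕ} (N : ℕ) (x : State C₁ C₂) : ℝ × ℝ × ℝ :=
  ((x.ys : ℝ) / N, (x.y : ℝ) / N, (x.z : ℝ) / N)

/-- The critical value `r_c` of the ratio of the capacities of levels 2 and 1. -/
def criticalRatio (p μ₀₁ μ₁₁ μ₀₂ : ℝ) : ℝ :=
  (p / μ₀₂) / (p / μ₀₁ + (1 - p) / μ₁₁)

end

end CallCenter

/-! Put `jobs = y + ys` and `excess = ys - z`; a server of level 2 is idle exactly when the excess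
is negative. The excess goes up at rate `μ₀₁ y` and down at rate `μ₀₂ (C₂ - z)`. Since `r < r_c`,
there is a fraction `c` with `μ₀₂ C₂ ≤ μ₀₁ c N` for large `N` while `jobs` still has upward drift of
order `N` below a level slightly above `c N` (`exists_level`). So `jobs` is pushed past `(c + δ) N`;
there either `ys` is of order `N`, and the excess is far above `0`, or `y` exceeds `c N` by a
multiple of `N`, and the excess drifts upwards.

This is made quantitative by exponentials of `-jobs` and `-excess` (`jobs_drift`, `excess_drift`).
`exists_lyapunov` combines them into `V ≥ 0` with `V ≥ 1` where `z > 0`, `V ≤ L exp (M N)`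
everywhere, and generator at most `-κ N V + K N exp (-η N)`. The relaxation rate is of order `N`, so
the fixed time `(M + 1) / κ` makes the mean of `V` exponentially small from every initial state.
From then on that mean grows at most at rate `K N exp (-η N)`, and a maximal inequality
(`one_sub_le_measure_forall_notMem`) excludes idle servers on all of `[t₁, T]` with probability
tending to `1`. -/

namespace CallCenter

/-! ### Finite Markov semigroups: positivity and Foster–Lyapunov bounds. -/

section MarkovMatrix

attribute [local instance] Matrix.linftyOpNormedRing Matrix.linftyOpNormedAlgebra

variable {S : Type*} [Fintype S]

/-- A `Q`-matrix: nonnegative off the diagonal, with vanishing row sums. -/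
structure IsQMatrix (Q : Matrix S S ℝ) : Prop where
  nonneg_off_diag : ∀ x y, x ≠ y → 0 ≤ Q x y
  row_sum : ∀ x, ∑ y, Q x y = 0

lemma IsQMatrix.mulVec_const {Q : Matrix S S ℝ} (hQ : IsQMatrix Q) (c : ℝ) (x : S) :
    Q.mulVec (fun _ => c) x = 0 := by
  change ∑ y, Q x y * c = 0
  rw [← Finset.sum_mul, hQ.row_sum, zero_mul]

variable [DecidableEq S]

lemma exp_apply_nonneg {M : Matrix S S ℝ} (hM : ∀ x y, 0 ≤ M x y) (x y : S) :
    0 ≤ NormedSpace.exp M x y := by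
  have hpow : ∀ (n : ℕ) (x y : S), 0 ≤ (M ^ n) x y := by
    intro n
    induction n with
    | zero =>
      intro x y
      rw [pow_zero, Matrix.one_apply]
      split_ifs <;> norm_num
    | succ k ih =>
      intro x y
      rw [pow_succ, Matrix.mul_apply]
      exact Finset.sum_nonneg fun z _ => mul_nonneg (ih x z) (hM z y)
  have h := NormedSpace.exp_series_hasSum_exp' (𝕂 := ℝ) M
  have h' : HasSum (fun n : ℕ => ((n.factorial : ℝ)⁻¹ • M ^ n) x y) (NormedSpace.exp M x y) :=
    Pi.hasSum.1 (Pi.hasSum.1 h x) y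
  refine h'.nonneg fun n => ?_
  rw [Matrix.smul_apply, smul_eq_mul]
  exact mul_nonneg (by positivity) (hpow n x y)

/-- Adding a large multiple `c` of the identity makes all entries of `t • Q` nonnegative; the
multiple commutes with `t • Q` and only contributes the positive factor `exp (-c)`. -/
lemma IsQMatrix.exp_smul_nonneg {Q : Matrix S S ℝ} (hQ : IsQMatrix Q) {t : ℝ} (ht : 0 ≤ t)
    (x y : S) : 0 ≤ NormedSpace.exp (t • Q) x y := by
  set c : ℝ := ∑ z, |t * Q z z| with hc
  have hsplit : t • Q = (t • Q + c • (1 : Matrix S S ℝ)) + (-c) • (1 : Matrix S S ℝ) := by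
    rw [neg_smul, add_neg_cancel_right]
  have hcomm : Commute (t • Q + c • (1 : Matrix S S ℝ)) ((-c) • (1 : Matrix S S ℝ)) :=
    (Commute.one_right _).smul_right _
  have hexp : NormedSpace.exp ((-c) • (1 : Matrix S S ℝ)) =
      Real.exp (-c) • (1 : Matrix S S ℝ) := by
    have := NormedSpace.algebraMap_exp_comm (𝕂 := ℝ) (𝔸 := Matrix S S ℝ) (-c)
    rw [Algebra.algebraMap_eq_smul_one, Algebra.algebraMap_eq_smul_one, ← Real.exp_eq_exp_ℝ]
      at this
    exact this.symm
  rw [hsplit, Matrix.exp_add_of_commute _ _ hcomm, hexp, mul_smul_comm, mul_one,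
    Matrix.smul_apply, smul_eq_mul]
  refine mul_nonneg (Real.exp_pos _).le (exp_apply_nonneg (fun u v => ?_) x y)
  rw [Matrix.add_apply, Matrix.smul_apply, Matrix.smul_apply, Matrix.one_apply, smul_eq_mul,
    smul_eq_mul]
  split_ifs with h
  · subst h
    have h1 : |t * Q u u| ≤ c :=
      Finset.single_le_sum (f := fun z => |t * Q z z|) (fun i _ => abs_nonneg _)
        (Finset.mem_univ u)
    have h2 := neg_abs_le (t * Q u u)
    linarith
  · rw [mul_zero, add_zero]
    exact mul_nonneg ht (hQ.nonneg_off_diag u v h)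

lemma hasDerivAt_exp_smul_mulVec (Q : Matrix S S ℝ) (V : S → ℝ) (x : S) (t : ℝ) :
    HasDerivAt (fun u : ℝ => (NormedSpace.exp (u • Q)).mulVec V x)
      ((NormedSpace.exp (t • Q)).mulVec (Q.mulVec V) x) t := by
  have h := hasDerivAt_exp_smul_const (𝕂 := ℝ) Q t
  let ℓ : Matrix S S ℝ →ₗ[ℝ] ℝ :=
    { toFun := fun M => M.mulVec V x
      map_add' := fun A B => by rw [Matrix.add_mulVec]; rfl
      map_smul' := fun c A => by rw [Matrix.smul_mulVec]; rfl }
  have h2 := (LinearMap.toContinuousLinearMap ℓ).hasFDerivAt.comp_hasDerivAt t h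
  rw [Matrix.mulVec_mulVec]
  exact h2

/-- Exponential decay of a function along the semigroup. -/
lemma IsQMatrix.exp_mulVec_le_exp_mul {Q : Matrix S S ℝ} (hQ : IsQMatrix Q) {W : S → ℝ} {a : ℝ}
    (hW : ∀ x, Q.mulVec W x ≤ -a * W x) {t : ℝ} (ht : 0 ≤ t) (x : S) :
    (NormedSpace.exp (t • Q)).mulVec W x ≤ Real.exp (-a * t) * W x := by
  -- `g` is antitone because the semigroup has nonnegative entries. No sign of `W` is needed, so the
  -- bound also applies to `V - d / a`.
  set g : ℝ → ℝ := fun u => Real.exp (a * u) * (NormedSpace.exp (u • Q)).mulVec W x with hg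
  have hder : ∀ u, HasDerivAt g (Real.exp (a * u) *
      (NormedSpace.exp (u • Q)).mulVec (fun y => Q.mulVec W y + a * W y) x) u := by
    intro u
    have h1 : HasDerivAt (fun u => Real.exp (a * u)) (Real.exp (a * u) * a) u := by
      simpa using ((hasDerivAt_id u).const_mul a).exp
    have h2 := h1.mul (hasDerivAt_exp_smul_mulVec Q W x u)
    refine h2.congr_deriv ?_
    have : (fun y => Q.mulVec W y + a * W y) = Q.mulVec W + a • W := rfl
    rw [this, Matrix.mulVec_add, Matrix.mulVec_smul, Pi.add_apply, Pi.smul_apply, smul_eq_mul]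
    ring
  have hanti : AntitoneOn g (Set.Ici 0) := by
    refine antitoneOn_of_deriv_nonpos (convex_Ici 0)
      (fun u _ => (hder u).continuousAt.continuousWithinAt)
      (fun u _ => (hder u).differentiableAt.differentiableWithinAt) fun u hu => ?_
    rw [interior_Ici] at hu
    rw [(hder u).deriv]
    refine mul_nonpos_of_nonneg_of_nonpos (Real.exp_pos _).le ?_
    refine Finset.sum_nonpos fun y _ =>
      mul_nonpos_of_nonneg_of_nonpos (hQ.exp_smul_nonneg (le_of_lt hu) x y) ?_
    have := hW y
    linarith
  have h := hanti (Set.self_mem_Ici) (Set.mem_Ici.2 ht) ht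
  simp only [hg, mul_zero, Real.exp_zero, one_mul, zero_smul, NormedSpace.exp_zero,
    Matrix.one_mulVec] at h
  have he : Real.exp (-a * t) * Real.exp (a * t) = 1 := by
    rw [← Real.exp_add, neg_mul, neg_add_cancel, Real.exp_zero]
  calc _ = Real.exp (-a * t) * (Real.exp (a * t) * (NormedSpace.exp (t • Q)).mulVec W x) := by
        rw [← mul_assoc, he, one_mul]
    _ ≤ _ := mul_le_mul_of_nonneg_left h (Real.exp_pos _).le

/-- Conservation of mass: the decay estimate with `a = 0`, applied to both `c` and `-c`. -/
lemma IsQMatrix.exp_mulVec_const {Q : Matrix S S ℝ} (hQ : IsQMatrix Q) (c : ℝ) {t : ℝ}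
    (ht : 0 ≤ t) (x : S) : (NormedSpace.exp (t • Q)).mulVec (fun _ => c) x = c := by
  have key : ∀ c : ℝ, (NormedSpace.exp (t • Q)).mulVec (fun _ => c) x ≤ c := fun c => by
    simpa using hQ.exp_mulVec_le_exp_mul (W := fun _ => c) (a := 0)
      (fun y => by rw [hQ.mulVec_const]; simp) ht x
  refine le_antisymm (key c) ?_
  have h := key (-c)
  have h2 : (fun _ : S => -c) = -(fun _ : S => c) := rfl
  rw [h2, Matrix.mulVec_neg, Pi.neg_apply] at h
  linarith

/-- The Foster–Lyapunov estimate for a finite Markov semigroup. -/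
lemma IsQMatrix.exp_mulVec_le {Q : Matrix S S ℝ} (hQ : IsQMatrix Q) {V : S → ℝ} {a d : ℝ}
    (ha : 0 < a) (hV : ∀ x, Q.mulVec V x ≤ -a * V x + d) {t : ℝ} (ht : 0 ≤ t) (x : S) :
    (NormedSpace.exp (t • Q)).mulVec V x ≤
      Real.exp (-a * t) * V x + (1 - Real.exp (-a * t)) * (d / a) := by
  have hsub : ∀ (M : Matrix S S ℝ) y, M.mulVec (fun z => V z - d / a) y =
      M.mulVec V y - M.mulVec (fun _ => d / a) y := fun M y => by
    have : (fun z => V z - d / a) = V - fun _ => d / a := rfl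
    rw [this, Matrix.mulVec_sub, Pi.sub_apply]
  have h := hQ.exp_mulVec_le_exp_mul (W := fun z => V z - d / a) (a := a) (fun y => by
    rw [hsub, hQ.mulVec_const]
    have := hV y
    have : a * (d / a) = d := mul_div_cancel₀ d ha.ne'
    linarith) ht x
  rw [hsub, hQ.exp_mulVec_const _ ht] at h
  linarith

/-- The Foster–Lyapunov bound with its decay discarded, in the linear form that the maximal
inequality consumes. -/
lemma IsQMatrix.exp_mulVec_le_add {Q : Matrix S S ℝ} (hQ : IsQMatrix Q) {V : S → ℝ} {a d : ℝ}
    (ha : 0 < a) (hd : 0 ≤ d) (hV₀ : ∀ x, 0 ≤ V x)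
    (hV : ∀ x, Q.mulVec V x ≤ -a * V x + d) {t : ℝ} (ht : 0 ≤ t) (x : S) :
    (NormedSpace.exp (t • Q)).mulVec V x ≤ V x + t * d := by
  refine (hQ.exp_mulVec_le ha hV ht x).trans (add_le_add ?_ ?_)
  · refine mul_le_of_le_one_left (hV₀ x) (Real.exp_le_one_iff.2 ?_)
    rw [neg_mul, neg_nonpos]
    positivity
  · have h : 1 - Real.exp (-a * t) ≤ a * t := by
      have := Real.add_one_le_exp (-a * t)
      linarith
    calc _ ≤ a * t * (d / a) := mul_le_mul_of_nonneg_right h (by positivity)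
      _ = t * d := by field_simp

end MarkovMatrix

/-! ### Markov property and maximal inequality for jump processes. -/

section JumpProcess

variable {S : Type*} [Fintype S] [DecidableEq S] {Q : Matrix S S ℝ}
  {Ω : Type*} [MeasurableSpace Ω] {P : Measure Ω} {X : ℝ≥0 → Ω → S}

lemma IsMarkovJumpProcess.measurableSet_mem (hX : IsMarkovJumpProcess Q P X) (t : ℝ≥0)
    (B : Set S) : MeasurableSet {ω | X t ω ∈ B} := by
  have : {ω | X t ω ∈ B} = ⋃ x ∈ B, {ω | X t ω = x} := by
    ext ω
    simp
  rw [this]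
  exact B.toFinite.measurableSet_biUnion fun x _ => hX.measurableSet_eq t x

lemma IsMarkovJumpProcess.measurableSet_forall_le (hX : IsMarkovJumpProcess Q P X)
    (τ : ℕ → ℝ≥0) (D : ℕ → Set S) (n : ℕ) :
    MeasurableSet {ω | ∀ i ≤ n, X (τ i) ω ∈ D i} := by
  have : {ω | ∀ i ≤ n, X (τ i) ω ∈ D i} = ⋂ i ∈ Finset.range (n + 1), {ω | X (τ i) ω ∈ D i} := by
    ext ω
    simp
  rw [this]
  exact Finset.measurableSet_biInter _ fun i _ => hX.measurableSet_mem _ _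

variable [IsProbabilityMeasure P]

lemma IsMarkovJumpProcess.sum_measureReal_inter (hX : IsMarkovJumpProcess Q P X) {A : Set Ω}
    (hA : MeasurableSet A) (t : ℝ≥0) :
    ∑ x, P.real (A ∩ {ω | X t ω = x}) = P.real A := by
  rw [← measureReal_biUnion_finset]
  · congr 1
    ext ω
    simp
  · intro x _ y _ hxy
    refine Set.disjoint_left.2 fun ω h1 h2 => hxy ?_
    exact h1.2.symm.trans h2.2
  · exact fun x _ => hA.inter (hX.measurableSet_eq t x)

/-- The one-step Markov property, given a past of rectangular form. -/
lemma IsMarkovJumpProcess.measureReal_step (hX : IsMarkovJumpProcess Q P X) {τ : ℕ → ℝ≥0}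
    (hτ : Monotone τ) (D : ℕ → Set S) (n : ℕ) (x y : S) :
    P.real ({ω | ∀ i ≤ n, X (τ i) ω ∈ D i} ∩ {ω | X (τ n) ω = x} ∩ {ω | X (τ (n + 1)) ω = y}) =
      P.real ({ω | ∀ i ≤ n, X (τ i) ω ∈ D i} ∩ {ω | X (τ n) ω = x}) *
        NormedSpace.exp (((τ (n + 1) : ℝ) - τ n) • Q) x y := by
  classical
  -- The Markov property is given for single trajectories, so the past is split into the finitely
  -- many trajectories in `W`. The default value `y` of `e w` beyond `n` encodes the next state.
  let W : Finset (Fin (n + 1) → S) :=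
    Finset.univ.filter fun w => (∀ i : Fin (n + 1), w i ∈ D i) ∧ w (Fin.last n) = x
  let e : (Fin (n + 1) → S) → ℕ → S := fun w i => if h : i < n + 1 then w ⟨i, h⟩ else y
  have he : ∀ w i (h : i < n + 1), e w i = w ⟨i, h⟩ := fun w i h => dif_pos h
  have he' : ∀ w, e w (n + 1) = y := fun w => dif_neg (lt_irrefl _)
  have hdisj : ∀ w w' : Fin (n + 1) → S, ∀ ω, (∀ i ≤ n, X (τ i) ω = e w i) →
      (∀ i ≤ n, X (τ i) ω = e w' i) → w = w' := by
    intro w w' ω h h'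
    ext ⟨i, hi⟩
    rw [← he w i hi, ← he w' i hi, ← h i (by omega), ← h' i (by omega)]
  have hpast : {ω | ∀ i ≤ n, X (τ i) ω ∈ D i} ∩ {ω | X (τ n) ω = x} =
      ⋃ w ∈ W, {ω | ∀ i ≤ n, X (τ i) ω = e w i} := by
    ext ω
    simp only [Set.mem_inter_iff, Set.mem_ofPred_eq, Set.mem_iUnion, exists_prop, W,
      Finset.mem_filter, Finset.mem_univ, true_and]
    constructor
    · rintro ⟨h1, h2⟩
      refine ⟨fun i => X (τ i) ω, ⟨fun i => h1 i (by omega), h2⟩, fun i hi => ?_⟩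
      exact (he (fun i : Fin (n + 1) => X (τ i) ω) i (by omega)).symm
    · rintro ⟨w, ⟨h1, h2⟩, h3⟩
      refine ⟨fun i hi => ?_, ?_⟩
      · rw [h3 i hi, he w i (by omega)]
        exact h1 ⟨i, by omega⟩
      · rw [h3 n le_rfl, he w n (by omega)]
        exact h2
  have hmeas : ∀ (m : ℕ) (w : Fin (n + 1) → S),
      MeasurableSet {ω | ∀ i ≤ m, X (τ i) ω = e w i} := fun m w =>
    hX.measurableSet_forall_le τ (fun i => {e w i}) m
  have hfut : {ω | ∀ i ≤ n, X (τ i) ω ∈ D i} ∩ {ω | X (τ n) ω = x} ∩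
      {ω | X (τ (n + 1)) ω = y} = ⋃ w ∈ W, {ω | ∀ i ≤ n + 1, X (τ i) ω = e w i} := by
    rw [hpast, Set.iUnion₂_inter]
    refine Set.iUnion₂_congr fun w _ => ?_
    ext ω
    simp only [Set.mem_inter_iff, Set.mem_ofPred_eq]
    constructor
    · rintro ⟨h1, h2⟩ i hi
      rcases Nat.lt_or_ge i (n + 1) with h | h
      · exact h1 i (by omega)
      · obtain rfl : i = n + 1 := le_antisymm hi h
        rw [he', h2]
    · intro h
      exact ⟨fun i hi => h i (by omega), by rw [h (n + 1) le_rfl, he']⟩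
  rw [hfut, hpast, measureReal_biUnion_finset _ fun w _ => hmeas _ w,
    measureReal_biUnion_finset _ fun w _ => hmeas _ w, Finset.sum_mul]
  · refine Finset.sum_congr rfl fun w hw => ?_
    have hwx : w ⟨n, Nat.lt_succ_self n⟩ = x := (Finset.mem_filter.1 hw).2.2
    rw [hX.markov n τ (e w) hτ, he' w, he w n (Nat.lt_succ_self n), hwx]
  · intro w _ w' _ hne
    exact Set.disjoint_left.2 fun ω h h' => hne (hdisj w w' ω h h')
  · intro w _ w' _ hne
    exact Set.disjoint_left.2 fun ω h h' => hne
      (hdisj w w' ω (fun i hi => h i (by omega)) fun i hi => h' i (by omega))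

lemma IsMarkovJumpProcess.sum_measureReal_mul_step (hX : IsMarkovJumpProcess Q P X)
    {τ : ℕ → ℝ≥0} (hτ : Monotone τ) (D : ℕ → Set S) (n : ℕ) (V : S → ℝ) :
    ∑ y, P.real ({ω | ∀ i ≤ n, X (τ i) ω ∈ D i} ∩ {ω | X (τ (n + 1)) ω = y}) * V y =
      ∑ x, P.real ({ω | ∀ i ≤ n, X (τ i) ω ∈ D i} ∩ {ω | X (τ n) ω = x}) *
        (NormedSpace.exp (((τ (n + 1) : ℝ) - τ n) • Q)).mulVec V x := by
  have h1 : ∀ y, P.real ({ω | ∀ i ≤ n, X (τ i) ω ∈ D i} ∩ {ω | X (τ (n + 1)) ω = y}) =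
      ∑ x, P.real ({ω | ∀ i ≤ n, X (τ i) ω ∈ D i} ∩ {ω | X (τ n) ω = x}) *
        NormedSpace.exp (((τ (n + 1) : ℝ) - τ n) • Q) x y := by
    intro y
    rw [← hX.sum_measureReal_inter
      ((hX.measurableSet_forall_le τ D n).inter (hX.measurableSet_eq _ y)) (τ n)]
    refine Finset.sum_congr rfl fun x _ => ?_
    rw [Set.inter_right_comm, hX.measureReal_step hτ]
  simp_rw [h1, Finset.sum_mul]
  rw [Finset.sum_comm]
  refine Finset.sum_congr rfl fun x _ => ?_
  rw [Matrix.mulVec, dotProduct, Finset.mul_sum]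
  exact Finset.sum_congr rfl fun y _ => by ring

lemma IsMarkovJumpProcess.sum_measureReal_mul_le (hX : IsMarkovJumpProcess Q P X) (t : ℝ≥0)
    {V : S → ℝ} {c : ℝ} (hV : ∀ x, (NormedSpace.exp ((t : ℝ) • Q)).mulVec V x ≤ c) :
    ∑ y, P.real {ω | X t ω = y} * V y ≤ c := by
  let τ : ℕ → ℝ≥0 := fun i => if i = 0 then 0 else t
  have hτ : Monotone τ := by
    intro i j hij
    simp only [τ]
    split_ifs with h1 h2 h2
    · exact le_rfl
    · exact zero_le
    · omega
    · exact le_rfl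
  have h := hX.sum_measureReal_mul_step hτ (fun _ => Set.univ) 0 V
  simp only [Set.mem_univ, implies_true, Set.ofPred_true, Set.univ_inter, τ, zero_add,
    one_ne_zero, if_false, if_true, NNReal.coe_zero, sub_zero] at h
  rw [h]
  have hsum := hX.sum_measureReal_inter MeasurableSet.univ 0
  simp only [Set.univ_inter, probReal_univ] at hsum
  calc _ ≤ ∑ x, P.real {ω | X 0 ω = x} * c :=
        Finset.sum_le_sum fun x _ => mul_le_mul_of_nonneg_left (hV x) measureReal_nonneg
    _ = c := by rw [← Finset.sum_mul, hsum, one_mul]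

/-- The maximal inequality for a function with bounded drift, along finitely many times. -/
lemma IsMarkovJumpProcess.measureReal_exists_mem_le (hX : IsMarkovJumpProcess Q P X)
    {τ : ℕ → ℝ≥0} (hτ : Monotone τ) {V : S → ℝ} {B : Set S} {d : ℝ} (hd : 0 ≤ d)
    (hV₀ : ∀ x, 0 ≤ V x) (hVB : ∀ x ∈ B, 1 ≤ V x)
    (hV : ∀ t : ℝ, 0 ≤ t → ∀ x, (NormedSpace.exp (t • Q)).mulVec V x ≤ V x + t * d) (n : ℕ) :
    P.real {ω | ∃ i ≤ n, X (τ i) ω ∈ B} ≤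
      ∑ x, P.real {ω | X (τ 0) ω = x} * V x + ((τ n : ℝ) - τ 0) * d := by
  let A : ℕ → Set Ω := fun n => {ω | ∀ i ≤ n, X (τ i) ω ∈ Bᶜ}
  have hA : ∀ n, MeasurableSet (A n) := hX.measurableSet_forall_le τ fun _ => Bᶜ
  -- Discarding the paths that sit in `B` can only lower the mean of `V - 1`, as `V ≥ 1` on `B`.
  have hkill : ∀ (C : Set Ω) (m : ℕ) (y : S),
      P.real (C ∩ {ω | X (τ m) ω ∈ Bᶜ} ∩ {ω | X (τ m) ω = y}) * (V y - 1) ≤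
        P.real (C ∩ {ω | X (τ m) ω = y}) * (V y - 1) := by
    intro C m y
    by_cases hy : y ∈ B
    · refine mul_le_mul_of_nonneg_right (measureReal_mono ?_) (sub_nonneg.2 (hVB y hy))
      exact fun ω h => ⟨h.1.1, h.2⟩
    · refine le_of_eq ?_
      congr 2
      ext ω
      simp only [Set.mem_inter_iff, Set.mem_ofPred_eq, Set.mem_compl_iff]
      constructor
      · exact fun h => ⟨h.1.1, h.2⟩
      · exact fun h => ⟨⟨h.1, by rw [h.2]; exact hy⟩, h.2⟩
  -- Supermartingale argument for `V - 1` killed on hitting `B`. Since `V ≥ 0`, the left side is at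
  -- least `-P (A n)`, which turns this into a bound on the hitting probability.
  have key : ∀ n, ∑ x, P.real (A n ∩ {ω | X (τ n) ω = x}) * (V x - 1) ≤
      ∑ x, P.real {ω | X (τ 0) ω = x} * V x - 1 + ((τ n : ℝ) - τ 0) * d := by
    intro n
    induction n with
    | zero =>
      have hsum := hX.sum_measureReal_inter MeasurableSet.univ (τ 0)
      simp only [Set.univ_inter, probReal_univ] at hsum
      have hA0 : A 0 = Set.univ ∩ {ω | X (τ 0) ω ∈ Bᶜ} := by
        ext ω
        simp [A]
      calc _ ≤ ∑ x, P.real {ω | X (τ 0) ω = x} * (V x - 1) := by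
            refine Finset.sum_le_sum fun x _ => ?_
            have := hkill Set.univ 0 x
            rwa [← hA0, Set.univ_inter] at this
        _ = _ := by
            simp only [mul_sub, mul_one, Finset.sum_sub_distrib, hsum]
            ring
    | succ n ih =>
      have hAs : A (n + 1) = A n ∩ {ω | X (τ (n + 1)) ω ∈ Bᶜ} := by
        ext ω
        simp only [A, Set.mem_inter_iff, Set.mem_ofPred_eq]
        constructor
        · exact fun h => ⟨fun i hi => h i (by omega), h _ le_rfl⟩
        · rintro ⟨h1, h2⟩ i hi
          rcases Nat.lt_or_ge i (n + 1) with h | h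
          · exact h1 i (by omega)
          · obtain rfl : i = n + 1 := le_antisymm hi h
            exact h2
      have hstep : (0 : ℝ) ≤ (τ (n + 1) : ℝ) - τ n :=
        sub_nonneg.2 (NNReal.coe_le_coe.2 (hτ (Nat.le_succ n)))
      have hsumn := hX.sum_measureReal_inter (hA n) (τ n)
      have hsumn' := hX.sum_measureReal_inter (hA n) (τ (n + 1))
      have hstepsum := hX.sum_measureReal_mul_step hτ (fun _ => Bᶜ) n V
      have hle : P.real (A n) ≤ 1 := measureReal_le_one
      calc _ ≤ ∑ y, P.real (A n ∩ {ω | X (τ (n + 1)) ω = y}) * (V y - 1) := by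
            rw [hAs]
            exact Finset.sum_le_sum fun y _ => hkill _ _ y
        _ = ∑ x, P.real (A n ∩ {ω | X (τ n) ω = x}) *
              (NormedSpace.exp (((τ (n + 1) : ℝ) - τ n) • Q)).mulVec V x - P.real (A n) := by
            simp only [mul_sub, mul_one, Finset.sum_sub_distrib, hsumn']
            rw [hstepsum]
        _ ≤ ∑ x, P.real (A n ∩ {ω | X (τ n) ω = x}) *
              (V x + ((τ (n + 1) : ℝ) - τ n) * d) - P.real (A n) :=
            sub_le_sub_right (Finset.sum_le_sum fun x _ =>
              mul_le_mul_of_nonneg_left (hV _ hstep x) measureReal_nonneg) _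
        _ = ∑ x, P.real (A n ∩ {ω | X (τ n) ω = x}) * (V x - 1) +
              P.real (A n) * (((τ (n + 1) : ℝ) - τ n) * d) := by
            simp only [mul_sub, mul_add, mul_one, Finset.sum_sub_distrib, Finset.sum_add_distrib,
              ← Finset.sum_mul, hsumn]
            ring
        _ ≤ ∑ x, P.real (A n ∩ {ω | X (τ n) ω = x}) * (V x - 1) +
              ((τ (n + 1) : ℝ) - τ n) * d :=
            (add_le_add_iff_left _).2 (mul_le_of_le_one_left (mul_nonneg hstep hd) hle)
        _ ≤ _ := by linarith
  have hcompl : {ω | ∃ i ≤ n, X (τ i) ω ∈ B} = (A n)ᶜ := by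
    ext ω
    simp [A]
  have hsum := hX.sum_measureReal_inter (hA n) (τ n)
  have hnn : 0 ≤ ∑ x, P.real (A n ∩ {ω | X (τ n) ω = x}) * V x :=
    Finset.sum_nonneg fun x _ => mul_nonneg measureReal_nonneg (hV₀ x)
  have hk := key n
  simp only [mul_sub, mul_one, Finset.sum_sub_distrib, hsum] at hk
  rw [hcompl, probReal_compl_eq_one_sub (hA n)]
  linarith

/-- Take a mesh finer than `v - u` and the first grid point strictly after `u`. -/
lemma exists_dyadic_between {a b u v : ℝ} (hab : a < b) (hau : a ≤ u) (huv : u < v)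
    (hvb : v ≤ b) :
    ∃ k i : ℕ, i ≤ 2 ^ k ∧ u < a + (b - a) * (i / 2 ^ k) ∧ a + (b - a) * (i / 2 ^ k) < v := by
  have hD : 0 < b - a := sub_pos.2 hab
  obtain ⟨k, hk⟩ := exists_pow_lt_of_lt_one (div_pos (sub_pos.2 huv) hD)
    (by norm_num : (1 / 2 : ℝ) < 1)
  rw [one_div, inv_pow, lt_div_iff₀ hD] at hk
  have h2 : (0 : ℝ) < 2 ^ k := by positivity
  set q : ℝ := 2 ^ k * ((u - a) / (b - a)) with hq
  have hq0 : 0 ≤ q := mul_nonneg h2.le (div_nonneg (sub_nonneg.2 hau) hD.le)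
  have hqu : (b - a) * (q / 2 ^ k) = u - a := by
    rw [hq]
    field_simp
  have hlow : (b - a) * (q / 2 ^ k) < (b - a) * (((⌊q⌋₊ + 1 : ℕ) : ℝ) / 2 ^ k) := by
    push_cast
    have := Nat.lt_floor_add_one q
    gcongr
  have hupp : (b - a) * (((⌊q⌋₊ + 1 : ℕ) : ℝ) / 2 ^ k) ≤ (b - a) * ((q + 1) / 2 ^ k) := by
    push_cast
    have := Nat.floor_le hq0
    gcongr
  have hupp' : (b - a) * ((q + 1) / 2 ^ k) = u - a + (2 ^ k)⁻¹ * (b - a) := by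
    rw [add_div, mul_add, hqu, one_div, mul_comm (b - a)]
  refine ⟨k, ⌊q⌋₊ + 1, ?_, by linarith, by linarith⟩
  have hlt : (b - a) * (((⌊q⌋₊ + 1 : ℕ) : ℝ) / 2 ^ k) < (b - a) * 1 := by linarith
  have hlt' := lt_of_mul_lt_mul_left hlt hD.le
  rw [div_lt_one h2] at hlt'
  exact_mod_cast hlt'.le

/-- The maximal inequality for a function with bounded drift, along an interval of times. -/
lemma IsMarkovJumpProcess.one_sub_le_measure_forall_notMem (hX : IsMarkovJumpProcess Q P X)
    {V : S → ℝ} {B : Set S} {c d : ℝ} (hd : 0 ≤ d) {t₁ T : ℝ≥0} (hT : t₁ ≤ T)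
    (hV₀ : ∀ x, 0 ≤ V x) (hVB : ∀ x ∈ B, 1 ≤ V x)
    (hV : ∀ t : ℝ, 0 ≤ t → ∀ x, (NormedSpace.exp (t • Q)).mulVec V x ≤ V x + t * d)
    (hc : ∀ x, (NormedSpace.exp ((t₁ : ℝ) • Q)).mulVec V x ≤ c) :
    1 - ENNReal.ofReal (c + ((T : ℝ) - t₁) * d) ≤
      P {ω | ∀ t ∈ Set.Icc t₁ T, X t ω ∉ B} := by
  -- Nested dyadic grids of `[t₁, T]`: the events `E k` increase, and their common bound passes to
  -- the union.
  let τ : ℕ → ℕ → ℝ≥0 := fun k i => t₁ + (T - t₁) * ((i : ℝ≥0) / 2 ^ k)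
  have hτ : ∀ k, Monotone (τ k) := by
    intro k i j hij
    simp only [τ]
    gcongr
  have hτ0 : ∀ k, τ k 0 = t₁ := by simp [τ]
  have hτe : ∀ k, τ k (2 ^ k) = T := by
    intro k
    simp only [τ, Nat.cast_pow, Nat.cast_ofNat]
    rw [div_self (by positivity), mul_one, add_tsub_cancel_of_le hT]
  have hτc : ∀ k i, (τ k i : ℝ) = t₁ + (T - t₁) * (i / 2 ^ k) := by
    intro k i
    simp [τ, NNReal.coe_sub hT]
  let E : ℕ → Set Ω := fun k => {ω | ∃ i ≤ 2 ^ k, X (τ k i) ω ∈ B}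
  have hEmono : Monotone E := by
    refine monotone_nat_of_le_succ fun k ω => ?_
    rintro ⟨i, hi, hB⟩
    refine ⟨2 * i, by rw [pow_succ]; omega, ?_⟩
    have : τ (k + 1) (2 * i) = τ k i := by
      simp only [τ, Nat.cast_mul, Nat.cast_ofNat, pow_succ']
      rw [mul_div_mul_left _ _ two_ne_zero]
    rwa [this]
  have hEmeas : ∀ k, MeasurableSet (E k) := by
    intro k
    have : E k = {ω | ∀ i ≤ 2 ^ k, X (τ k i) ω ∈ Bᶜ}ᶜ := by
      ext ω
      simp [E]
    rw [this]
    exact (hX.measurableSet_forall_le (τ k) (fun _ => Bᶜ) _).compl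
  have hE : ∀ k, P (E k) ≤ ENNReal.ofReal (c + ((T : ℝ) - t₁) * d) := by
    intro k
    have h := hX.measureReal_exists_mem_le (hτ k) hd hV₀ hVB hV (2 ^ k)
    rw [hτ0, hτe] at h
    rw [← ofReal_measureReal]
    exact ENNReal.ofReal_le_ofReal (h.trans (by gcongr; exact hX.sum_measureReal_mul_le t₁ hc))
  have hU : P (⋃ k, E k) ≤ ENNReal.ofReal (c + ((T : ℝ) - t₁) * d) := by
    rw [hEmono.measure_iUnion]
    exact iSup_le hE
  -- By right-continuity a visit to `B` at `t < T` lasts until some later grid point; `T` itself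
  -- lies on every grid.
  have hsub : (⋃ k, E k)ᶜ ⊆ {ω | ∀ t ∈ Set.Icc t₁ T, X t ω ∉ B} := by
    intro ω hω t ht hB
    refine hω (Set.mem_iUnion.2 ?_)
    rcases ht.2.eq_or_lt with rfl | hlt
    · exact ⟨0, 2 ^ 0, le_rfl, by rwa [hτe]⟩
    · obtain ⟨u, hu, hsubu⟩ := (mem_nhdsGT_iff_exists_Ioo_subset' hlt).1
        (hX.right_continuous ω t)
      obtain ⟨k, i, hi, h1, h2⟩ := exists_dyadic_between (a := t₁) (b := T) (u := t)
        (v := min u T) (NNReal.coe_lt_coe.2 (ht.1.trans_lt hlt)) (NNReal.coe_le_coe.2 ht.1)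
        (by rw [← NNReal.coe_min]; exact NNReal.coe_lt_coe.2 (lt_min hu hlt)) (min_le_right _ _)
      rw [← hτc] at h1 h2
      have h3 : τ k i ∈ Set.Ioo t u :=
        ⟨NNReal.coe_lt_coe.1 h1, NNReal.coe_lt_coe.1 (h2.trans_le (min_le_left _ _))⟩
      have h4 : X (τ k i) ω = X t ω := hsubu h3
      exact ⟨k, i, hi, by rwa [h4]⟩
  calc _ ≤ 1 - P (⋃ k, E k) := tsub_le_tsub_left hU 1
    _ = P (⋃ k, E k)ᶜ := by
        rw [measure_compl (MeasurableSet.iUnion hEmeas) (measure_ne_top _ _), measure_univ]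
    _ ≤ _ := measure_mono hsub

end JumpProcess

/-! ### The generator on functions of `jobs` and `excess`. -/

section Drift

variable {p μ₀₁ μ₁₁ μ₀₂ : ℝ} {C₁ C₂ : ℕ}

lemma rate_nonneg (hp : p ∈ Set.Icc (0 : ℝ) 1) (h₀₁ : 0 ≤ μ₀₁) (h₁₁ : 0 ≤ μ₁₁) (h₀₂ : 0 ≤ μ₀₂)
    (x x' : State C₁ C₂) : 0 ≤ rate p μ₀₁ μ₁₁ μ₀₂ x x' := by
  have hp' : 0 ≤ 1 - p := sub_nonneg.2 hp.2
  have hp0 := hp.1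
  have h1 : (0 : ℝ) ≤ (C₁ : ℝ) - x.ys - x.y := by
    have : ((x.y + x.ys : ℕ) : ℝ) ≤ C₁ := Nat.cast_le.2 x.level_one_le
    push_cast at this
    linarith
  have h2 : (0 : ℝ) ≤ (C₂ : ℝ) - x.z := sub_nonneg.2 (Nat.cast_le.2 x.idle_le)
  have hite : ∀ (q : Prop) [Decidable q] (c : ℝ), 0 ≤ c → 0 ≤ if q then c else 0 := by
    intro q _ c hc
    split_ifs
    exacts [hc, le_rfl]
  unfold rate
  refine add_nonneg (add_nonneg (add_nonneg (add_nonneg (add_nonneg (add_nonneg ?_ ?_) ?_) ?_)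
    ?_) ?_) ?_ <;> exact hite _ _ (by positivity)

lemma generator_apply_of_ne {x x' : State C₁ C₂} (h : x ≠ x') :
    generator p μ₀₁ μ₁₁ μ₀₂ C₁ C₂ x x' = rate p μ₀₁ μ₁₁ μ₀₂ x x' := if_neg h

lemma generator_apply_self (x : State C₁ C₂) :
    generator p μ₀₁ μ₁₁ μ₀₂ C₁ C₂ x x =
      -∑ x' ∈ Finset.univ.erase x, rate p μ₀₁ μ₁₁ μ₀₂ x x' := if_pos rfl

lemma isQMatrix_generator (hp : p ∈ Set.Icc (0 : ℝ) 1) (h₀₁ : 0 ≤ μ₀₁) (h₁₁ : 0 ≤ μ₁₁)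
    (h₀₂ : 0 ≤ μ₀₂) : IsQMatrix (generator p μ₀₁ μ₁₁ μ₀₂ C₁ C₂) where
  nonneg_off_diag x y hxy := by
    rw [generator_apply_of_ne hxy]
    exact rate_nonneg hp h₀₁ h₁₁ h₀₂ x y
  row_sum x := by
    rw [← Finset.add_sum_erase _ _ (Finset.mem_univ x), generator_apply_self, neg_add_eq_zero]
    exact Finset.sum_congr rfl fun y hy =>
      (generator_apply_of_ne (Finset.ne_of_mem_erase hy).symm).symm

lemma generator_mulVec (f : State C₁ C₂ → ℝ) (x : State C₁ C₂) :
    (generator p μ₀₁ μ₁₁ μ₀₂ C₁ C₂).mulVec f x =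
      ∑ x', rate p μ₀₁ μ₁₁ μ₀₂ x x' * (f x' - f x) := by
  rw [Matrix.mulVec, dotProduct, ← Finset.add_sum_erase _ _ (Finset.mem_univ x),
    ← Finset.add_sum_erase _ (fun x' => rate p μ₀₁ μ₁₁ μ₀₂ x x' * (f x' - f x))
      (Finset.mem_univ x), generator_apply_self, sub_self, mul_zero, zero_add, neg_mul,
    Finset.sum_mul, neg_add_eq_sub, ← Finset.sum_sub_distrib]
  refine Finset.sum_congr rfl fun y hy => ?_
  rw [generator_apply_of_ne (Finset.ne_of_mem_erase hy).symm]
  ring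

/-- Evaluates one summand of `rate`: a jump has at most one target, and the target may be missing
from the state space only if the rate vanishes. -/
lemma sum_ite_mul_eq {S : Type*} [Fintype S] {g : Prop} [Decidable g] {q : S → Prop}
    [DecidablePred q] {c D : ℝ} {F : S → ℝ} (hg : ∀ x, q x → g) (hF : ∀ x, q x → F x = D)
    (huniq : ∀ x x', q x → q x' → x = x') (hex : g → c = 0 ∨ ∃ x, q x) :
    ∑ x, (if q x then c else 0) * F x = if g then c * D else 0 := by
  split_ifs with h
  · rcases hex h with rfl | ⟨x, hx⟩
    · simp
    · rw [Finset.sum_eq_single x, if_pos hx, hF x hx]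
      · intro y _ hy
        rw [if_neg fun hqy => hy (huniq _ _ hqy hx), zero_mul]
      · exact fun hx' => absurd (Finset.mem_univ x) hx'
  · refine Finset.sum_eq_zero fun x _ => ?_
    rw [if_neg fun hq => h (hg x hq), zero_mul]

/-- The number of class `0` jobs at level 1. -/
def State.jobs (x : State C₁ C₂) : ℝ := x.y + x.ys

/-- The number of blocked jobs minus the number of idle servers at level 2. -/
def State.excess (x : State C₁ C₂) : ℝ := x.ys - x.z

lemma State.ys_eq_zero_of_idle (x : State C₁ C₂) (h : 0 < x.z) : x.ys = 0 := by
  rcases Nat.mul_eq_zero.1 x.blocked_mul_idle with h' | h'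
  · exact h'
  · omega

/-- The generator applied to a function of the number of jobs and of the excess. -/
lemma generator_mulVec_jobs_excess (φ : ℝ → ℝ → ℝ) (x : State C₁ C₂) :
    (generator p μ₀₁ μ₁₁ μ₀₂ C₁ C₂).mulVec (fun x => φ x.jobs x.excess) x =
      (if x.z = 0 then μ₀₁ * x.y * (φ x.jobs (x.excess + 1) - φ x.jobs x.excess) else 0)
      + (if 0 < x.z then μ₀₁ * x.y * (1 - p) *
          (φ (x.jobs - 1) (x.excess + 1) - φ x.jobs x.excess) else 0)
      + (if 0 < x.z then μ₀₁ * x.y * p *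
          (φ x.jobs (x.excess + 1) - φ x.jobs x.excess) else 0)
      + (if True then μ₁₁ * p * ((C₁ : ℝ) - x.ys - x.y) *
          (φ (x.jobs + 1) x.excess - φ x.jobs x.excess) else 0)
      + (if 0 < x.ys then (1 - p) * μ₀₂ * C₂ *
          (φ (x.jobs - 1) (x.excess - 1) - φ x.jobs x.excess) else 0)
      + (if 0 < x.ys then p * μ₀₂ * C₂ *
          (φ x.jobs (x.excess - 1) - φ x.jobs x.excess) else 0)
      + (if x.ys = 0 then μ₀₂ * ((C₂ : ℝ) - x.z) *
          (φ x.jobs (x.excess - 1) - φ x.jobs x.excess) else 0) := by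
  have hl := x.level_one_le
  have hi := x.idle_le
  have hb := x.ys_eq_zero_of_idle
  have hφ : ∀ (x' : State C₁ C₂) (s w : ℝ), x'.jobs = s → x'.excess = w →
      φ x'.jobs x'.excess - φ x.jobs x.excess = φ s w - φ x.jobs x.excess := by
    rintro x' s w rfl rfl
    rfl
  have cast_succ : ∀ {a b : ℕ}, a = b + 1 → (a : ℝ) = b + 1 := fun h => by
    rw [h, Nat.cast_add, Nat.cast_one]
  rw [generator_mulVec]
  simp only [rate, add_mul, Finset.sum_add_distrib]
  refine congrArg₂ _ (congrArg₂ _ (congrArg₂ _ (congrArg₂ _ (congrArg₂ _ (congrArg₂ _ ?_ ?_)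
    ?_) ?_) ?_) ?_) ?_
  · refine sum_ite_mul_eq (fun _ h => h.1) ?_ ?_ ?_
    · rintro x' ⟨h0, h1, h2, h3⟩
      have h1 := cast_succ h1
      have h2 := cast_succ h2.symm
      refine hφ x' _ _ ?_ ?_ <;> simp only [State.jobs, State.excess, h3, h0] <;> linarith
    · rintro x' x'' ⟨_, h1, h2, h3⟩ ⟨_, h1', h2', h3'⟩
      ext <;> omega
    · intro h
      rcases Nat.eq_zero_or_pos x.y with hy | hy
      · left
        rw [hy, Nat.cast_zero, mul_zero]
      · right
        refine ⟨⟨x.ys + 1, x.y - 1, 0, by omega, by omega, by simp⟩, h, rfl, ?_, rfl⟩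
        change x.y - 1 + 1 = x.y
        omega
  · refine sum_ite_mul_eq (fun _ h => h.1) ?_ ?_ ?_
    · rintro x' ⟨h0, h1, h2, h3⟩
      have h0 := hb h0
      have h2 := cast_succ h2.symm
      have h3 := cast_succ h3.symm
      refine hφ x' _ _ ?_ ?_ <;> simp only [State.jobs, State.excess, h1, h0] <;> linarith
    · rintro x' x'' ⟨_, h1, h2, h3⟩ ⟨_, h1', h2', h3'⟩
      ext <;> omega
    · intro h
      rcases Nat.eq_zero_or_pos x.y with hy | hy
      · left
        rw [hy, Nat.cast_zero, mul_zero, zero_mul]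
      · right
        refine ⟨⟨0, x.y - 1, x.z - 1, by omega, by omega, by simp⟩, h, rfl, ?_, ?_⟩
        · change x.y - 1 + 1 = x.y
          omega
        · change x.z - 1 + 1 = x.z
          omega
  · refine sum_ite_mul_eq (fun _ h => h.1) ?_ ?_ ?_
    · rintro x' ⟨h0, h1, h2, h3⟩
      have h0 := hb h0
      have h3 := cast_succ h3.symm
      refine hφ x' _ _ ?_ ?_
      · simp only [State.jobs, h1, h0, h2]
      · simp only [State.excess, h1, h0]
        linarith
    · rintro x' x'' ⟨_, h1, h2, h3⟩ ⟨_, h1', h2', h3'⟩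
      ext <;> omega
    · intro h
      right
      refine ⟨⟨0, x.y, x.z - 1, by omega, by omega, by simp⟩, h, rfl, rfl, ?_⟩
      change x.z - 1 + 1 = x.z
      omega
  · refine sum_ite_mul_eq (fun _ _ => trivial) ?_ ?_ ?_
    · rintro x' ⟨h1, h2, h3⟩
      have h2 := cast_succ h2
      refine hφ x' _ _ ?_ ?_
      · simp only [State.jobs, h1]
        linarith
      · simp only [State.excess, h1, h3]
    · rintro x' x'' ⟨h1, h2, h3⟩ ⟨h1', h2', h3'⟩
      ext <;> omega
    · intro _
      rcases hl.eq_or_lt with he | hlt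
      · left
        have : (C₁ : ℝ) = x.y + x.ys := by exact_mod_cast he.symm
        rw [this]
        ring
      · right
        exact ⟨⟨x.ys, x.y + 1, x.z, by omega, hi, x.blocked_mul_idle⟩, rfl, rfl, rfl⟩
  · refine sum_ite_mul_eq (fun _ h => h.1) ?_ ?_ ?_
    · rintro x' ⟨h0, h1, h2, h3⟩
      have h1 := cast_succ h1.symm
      refine hφ x' _ _ ?_ ?_ <;> simp only [State.jobs, State.excess, h2, h3] <;> linarith
    · rintro x' x'' ⟨_, h1, h2, h3⟩ ⟨_, h1', h2', h3'⟩
      ext <;> omega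
    · intro h
      right
      have hz : x.z = 0 := by by_contra hz; have := hb (Nat.pos_of_ne_zero hz); omega
      refine ⟨⟨x.ys - 1, x.y, x.z, by omega, hi, by rw [hz, mul_zero]⟩, h, ?_, rfl, rfl⟩
      change x.ys - 1 + 1 = x.ys
      omega
  · refine sum_ite_mul_eq (fun _ h => h.1) ?_ ?_ ?_
    · rintro x' ⟨h0, h1, h2, h3⟩
      have h1 := cast_succ h1.symm
      have h2 := cast_succ h2
      refine hφ x' _ _ ?_ ?_ <;> simp only [State.jobs, State.excess, h3] <;> linarith
    · rintro x' x'' ⟨_, h1, h2, h3⟩ ⟨_, h1', h2', h3'⟩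
      ext <;> omega
    · intro h
      right
      have hz : x.z = 0 := by by_contra hz; have := hb (Nat.pos_of_ne_zero hz); omega
      refine ⟨⟨x.ys - 1, x.y + 1, x.z, by omega, hi, by rw [hz, mul_zero]⟩, h, ?_, rfl, rfl⟩
      change x.ys - 1 + 1 = x.ys
      omega
  · refine sum_ite_mul_eq (fun _ h => h.1) ?_ ?_ ?_
    · rintro x' ⟨h0, h1, h2, h3⟩
      have h3 := cast_succ h3
      refine hφ x' _ _ ?_ ?_
      · simp only [State.jobs, h0, h1, h2]
      · simp only [State.excess, h0, h1]
        linarith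
    · rintro x' x'' ⟨_, h1, h2, h3⟩ ⟨_, h1', h2', h3'⟩
      ext <;> omega
    · intro h
      rcases hi.eq_or_lt with he | hlt
      · left
        rw [he, sub_self, mul_zero]
      · right
        exact ⟨⟨0, x.y, x.z + 1, by omega, hlt, by simp⟩, h, rfl, rfl, rfl⟩

/-- An exact formula without case distinction: `ys` and `z` are never both positive, so the downward
rate is `μ₀₂ (C₂ - z)` in every state. -/
lemma generator_mulVec_exp_excess (θ : ℝ) (x : State C₁ C₂) :
    (generator p μ₀₁ μ₁₁ μ₀₂ C₁ C₂).mulVec (fun x => Real.exp (-θ * x.excess)) x =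
      Real.exp (-θ * x.excess) * (μ₀₁ * x.y * (Real.exp (-θ) - 1) +
        μ₀₂ * ((C₂ : ℝ) - x.z) * (Real.exp θ - 1)) := by
  rw [generator_mulVec_jobs_excess fun _ w => Real.exp (-θ * w)]
  have h1 : Real.exp (-θ * (x.excess + 1)) = Real.exp (-θ * x.excess) * Real.exp (-θ) := by
    rw [← Real.exp_add]; ring_nf
  have h2 : Real.exp (-θ * (x.excess - 1)) = Real.exp (-θ * x.excess) * Real.exp θ := by
    rw [← Real.exp_add]; ring_nf
  rw [h1, h2]
  rcases Nat.eq_zero_or_pos x.z with hz | hz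
  · rcases Nat.eq_zero_or_pos x.ys with hy | hy
    · simp only [hz, hy, lt_irrefl, if_true, if_false]
      ring
    · simp only [hz, hy, hy.ne', lt_irrefl, if_true, if_false, Nat.cast_zero]
      ring
  · simp only [hz, hz.ne', x.ys_eq_zero_of_idle hz, lt_irrefl, if_true, if_false]
    ring

/-- `D` dominates the rate of attempts to leave level 1. With `z = 0` a completed job merely becomes
blocked, so `μ₀₁ y` matters only when `z > 0`. -/
lemma generator_mulVec_exp_jobs_le (hp : p ∈ Set.Icc (0 : ℝ) 1) {Λ a D : ℝ} (hΛ : 0 ≤ Λ)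
    (hD : 0 ≤ D) (hD₂ : μ₀₂ * C₂ ≤ D) (x : State C₁ C₂) (hD₁ : 0 < x.z → μ₀₁ * x.y ≤ D) :
    (generator p μ₀₁ μ₁₁ μ₀₂ C₁ C₂).mulVec (fun x => Real.exp (-Λ * (x.jobs - a))) x ≤
      Real.exp (-Λ * (x.jobs - a)) * ((1 - p) * D * (Real.exp Λ - 1) +
        μ₁₁ * p * ((C₁ : ℝ) - x.jobs) * (Real.exp (-Λ) - 1)) := by
  rw [generator_mulVec_jobs_excess fun s _ => Real.exp (-Λ * (s - a))]
  have h1 : Real.exp (-Λ * (x.jobs + 1 - a)) =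
      Real.exp (-Λ * (x.jobs - a)) * Real.exp (-Λ) := by
    rw [← Real.exp_add]; ring_nf
  have h2 : Real.exp (-Λ * (x.jobs - 1 - a)) = Real.exp (-Λ * (x.jobs - a)) * Real.exp Λ := by
    rw [← Real.exp_add]; ring_nf
  have hs : (C₁ : ℝ) - x.ys - x.y = C₁ - x.jobs := by
    rw [State.jobs]
    ring
  rw [h1, h2, hs]
  set e := Real.exp (-Λ * (x.jobs - a))
  have he : 0 ≤ e * ((1 - p) * (Real.exp Λ - 1)) :=
    mul_nonneg (Real.exp_pos _).le (mul_nonneg (sub_nonneg.2 hp.2)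
      (sub_nonneg.2 (Real.one_le_exp hΛ)))
  rcases Nat.eq_zero_or_pos x.z with hz | hz
  · rcases Nat.eq_zero_or_pos x.ys with hy | hy
    · simp only [hz, hy, lt_irrefl, if_true, if_false]
      have := mul_nonneg he hD
      linarith
    · simp only [hz, hy, hy.ne', lt_irrefl, if_true, if_false]
      have := mul_le_mul_of_nonneg_left hD₂ he
      linarith
  · simp only [hz, hz.ne', x.ys_eq_zero_of_idle hz, lt_irrefl, if_true, if_false]
    have := mul_le_mul_of_nonneg_left (hD₁ hz) he
    linarith

end Drift

/-! ### Construction of the Lyapunov function. -/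

section Lyapunov

variable {p μ₀₁ μ₁₁ μ₀₂ : ℝ} {C₁ C₂ : ℕ}

/-- A biased walk with up rate `v` and smaller down rate `u` has an exponential of negative
drift. -/
lemma exists_exp_tilt {u v θ₀ : ℝ} (huv : u < v) (hθ₀ : 0 < θ₀) :
    ∃ θ κ : ℝ, 0 < θ ∧ θ < θ₀ ∧ 0 < κ ∧
      v * (Real.exp (-θ) - 1) + u * (Real.exp θ - 1) ≤ -κ := by
  have hcont : Tendsto (fun θ : ℝ => u * Real.exp θ) (𝓝[>] 0) (𝓝 (u * Real.exp 0)) :=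
    ((continuous_const.mul Real.continuous_exp).tendsto 0).mono_left nhdsWithin_le_nhds
  rw [Real.exp_zero, mul_one] at hcont
  obtain ⟨θ, h1, h2, h3⟩ := ((hcont.eventually (gt_mem_nhds huv)).and
    (Ioo_mem_nhdsGT hθ₀)).exists
  have hlt : Real.exp (-θ) < 1 := Real.exp_lt_one_iff.2 (neg_lt_zero.2 h2)
  -- The left side factors as `-(1 - exp (-θ)) (v - u exp θ)`, so any small `θ` with `u exp θ < v`
  -- works.
  refine ⟨θ, (1 - Real.exp (-θ)) * (v - u * Real.exp θ), h2, h3,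
    mul_pos (sub_pos.2 hlt) (sub_pos.2 h1), le_of_eq ?_⟩
  have hmul : Real.exp (-θ) * Real.exp θ = 1 := by
    rw [← Real.exp_add, neg_add_cancel, Real.exp_zero]
  linear_combination u * hmul

lemma State.jobs_nonneg (x : State C₁ C₂) : 0 ≤ x.jobs := by
  unfold State.jobs
  positivity

lemma State.jobs_le (x : State C₁ C₂) : x.jobs ≤ C₁ := by
  unfold State.jobs
  exact_mod_cast x.level_one_le

/-- Below `c C₁` the tilt gives decay; above it the exponential is itself at most `exp (-Λ (c - a)
C₁)`, so crude rate bounds suffice. -/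
lemma jobs_drift (hp : p ∈ Set.Icc (0 : ℝ) 1) (h₀₁ : 0 < μ₀₁) (h₁₁ : 0 < μ₁₁) {c a Λ κ : ℝ}
    (hc₀ : 0 ≤ c) (hc₁ : c ≤ 1) (hΛ : 0 < Λ) (hκ : 0 ≤ κ)
    (htilt : μ₁₁ * p * (1 - c) * (Real.exp (-Λ) - 1) + (1 - p) * μ₀₁ * c * (Real.exp Λ - 1) ≤ -κ)
    (hC₂ : μ₀₂ * C₂ ≤ μ₀₁ * c * C₁) (x : State C₁ C₂) :
    (generator p μ₀₁ μ₁₁ μ₀₂ C₁ C₂).mulVec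
        (fun x => Real.exp (-Λ * (x.jobs - a * C₁))) x ≤
      -(κ * C₁) * Real.exp (-Λ * (x.jobs - a * C₁)) +
        (μ₀₁ * (Real.exp Λ - 1) + κ) * C₁ * Real.exp (-(Λ * (c - a)) * C₁) := by
  have hexp : 0 ≤ Real.exp Λ - 1 := sub_nonneg.2 (Real.one_le_exp hΛ.le)
  have hexp' : Real.exp (-Λ) - 1 ≤ 0 :=
    sub_nonpos.2 (Real.exp_le_one_iff.2 (neg_nonpos.2 hΛ.le))
  have hp' : 0 ≤ 1 - p := sub_nonneg.2 hp.2
  have hp0 := hp.1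
  have hn : (0 : ℝ) ≤ C₁ := Nat.cast_nonneg _
  have hys : (0 : ℝ) ≤ x.ys := Nat.cast_nonneg _
  set n := (C₁ : ℝ)
  set e := Real.exp (-Λ * (x.jobs - a * n)) with he
  have he0 : 0 < e := Real.exp_pos _
  rcases le_total x.jobs (c * n) with hs | hs
  · have h := generator_mulVec_exp_jobs_le (μ₀₁ := μ₀₁) (μ₁₁ := μ₁₁) hp (a := a * n) hΛ.le
      (by positivity) hC₂ x fun _ => by
        have h : (x.y : ℝ) + x.ys ≤ c * n := hs
        have h' : (x.y : ℝ) ≤ c * n := by linarith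
        have := mul_le_mul_of_nonneg_left h' h₀₁.le
        linarith
    refine h.trans ?_
    have h1 : μ₁₁ * p * (n - x.jobs) * (Real.exp (-Λ) - 1) ≤
        μ₁₁ * p * (n - c * n) * (Real.exp (-Λ) - 1) := by
      refine mul_le_mul_of_nonpos_right ?_ hexp'
      gcongr
    have h2 := mul_le_mul_of_nonneg_right htilt hn
    have h3 : (1 - p) * (μ₀₁ * c * n) * (Real.exp Λ - 1) +
        μ₁₁ * p * (n - x.jobs) * (Real.exp (-Λ) - 1) ≤ -(κ * n) := by linarith
    have h4 := mul_le_mul_of_nonneg_left h3 he0.le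
    have h5 : 0 ≤ (μ₀₁ * (Real.exp Λ - 1) + κ) * n * Real.exp (-(Λ * (c - a)) * n) := by
      positivity
    linarith
  · have h := generator_mulVec_exp_jobs_le (μ₀₁ := μ₀₁) (μ₁₁ := μ₁₁) hp (a := a * n) hΛ.le
      (D := μ₀₁ * n) (by positivity)
      (hC₂.trans (by
        rw [mul_assoc]
        exact mul_le_mul_of_nonneg_left (mul_le_of_le_one_left hn hc₁) h₀₁.le)) x fun _ => by
        refine mul_le_mul_of_nonneg_left ?_ h₀₁.le
        have : (x.y : ℝ) + x.ys ≤ n := x.jobs_le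
        linarith
    refine h.trans ?_
    have h1 : μ₁₁ * p * (n - x.jobs) * (Real.exp (-Λ) - 1) ≤ 0 :=
      mul_nonpos_of_nonneg_of_nonpos
        (mul_nonneg (by positivity) (sub_nonneg.2 x.jobs_le)) hexp'
    have h2 : (1 - p) * (μ₀₁ * n) * (Real.exp Λ - 1) ≤ 1 * (μ₀₁ * n) * (Real.exp Λ - 1) := by
      gcongr
      linarith
    have h3 := mul_le_mul_of_nonneg_left (add_le_add h2 h1) he0.le
    have h4 : e ≤ Real.exp (-(Λ * (c - a)) * n) := by
      rw [he, Real.exp_le_exp]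
      have := mul_le_mul_of_nonneg_left hs hΛ.le
      linarith
    have h5 := mul_le_mul_of_nonneg_left h4
      (by positivity : 0 ≤ (μ₀₁ * (Real.exp Λ - 1) + κ) * n)
    linarith

/-- With `jobs ≥ (c + 2 h) C₁`, either the excess is at least `h C₁` and the exponential is tiny, or
`ys ≤ h C₁`, which forces `y ≥ (c + h) C₁` and the tilt applies. With fewer jobs only a crude bound
holds. -/
lemma excess_drift (h₀₁ : 0 < μ₀₁) (h₀₂ : 0 < μ₀₂) {c h θ κ : ℝ}
    (hc₀ : 0 ≤ c) (hh : 0 ≤ h) (hθ : 0 < θ) (hκ : 0 ≤ κ)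
    (htilt : μ₀₁ * (c + h) * (Real.exp (-θ) - 1) + μ₀₁ * c * (Real.exp θ - 1) ≤ -κ)
    (hC₂ : μ₀₂ * C₂ ≤ μ₀₁ * c * C₁) (x : State C₁ C₂) :
    (generator p μ₀₁ μ₁₁ μ₀₂ C₁ C₂).mulVec (fun x => Real.exp (-θ * x.excess)) x ≤
      -(κ * C₁) * Real.exp (-θ * x.excess) +
        (μ₀₁ * c * (Real.exp θ - 1) + κ) * C₁ *
          (if x.jobs < (c + 2 * h) * C₁ then Real.exp (-θ * x.excess)
            else Real.exp (-(θ * h) * C₁)) := by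
  have hexp : 0 ≤ Real.exp θ - 1 := sub_nonneg.2 (Real.one_le_exp hθ.le)
  have hexp' : Real.exp (-θ) - 1 ≤ 0 :=
    sub_nonpos.2 (Real.exp_le_one_iff.2 (neg_nonpos.2 hθ.le))
  have hn : (0 : ℝ) ≤ C₁ := Nat.cast_nonneg _
  have hy : (0 : ℝ) ≤ x.y := Nat.cast_nonneg _
  have hz : (0 : ℝ) ≤ x.z := Nat.cast_nonneg _
  rw [generator_mulVec_exp_excess]
  set n := (C₁ : ℝ)
  set e := Real.exp (-θ * x.excess) with he
  have he0 : 0 < e := Real.exp_pos _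
  have hdown : μ₀₂ * ((C₂ : ℝ) - x.z) * (Real.exp θ - 1) ≤ μ₀₁ * c * n * (Real.exp θ - 1) := by
    refine mul_le_mul_of_nonneg_right ?_ hexp
    have := mul_nonneg h₀₂.le hz
    linarith
  have hup : μ₀₁ * x.y * (Real.exp (-θ) - 1) ≤ 0 :=
    mul_nonpos_of_nonneg_of_nonpos (by positivity) hexp'
  have hall := mul_le_mul_of_nonneg_left (add_le_add hup hdown) he0.le
  split_ifs with hs
  · linarith
  · rcases le_total x.excess (h * n) with hw | hw
    · have hys : (x.ys : ℝ) ≤ h * n := by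
        rcases Nat.eq_zero_or_pos x.z with hz0 | hz0
        · simpa [State.excess, hz0] using hw
        · rw [x.ys_eq_zero_of_idle hz0, Nat.cast_zero]
          positivity
      have hyl : (c + h) * n ≤ x.y := by
        have : (c + 2 * h) * n ≤ x.y + x.ys := not_lt.1 hs
        linarith
      have h1 : μ₀₁ * x.y * (Real.exp (-θ) - 1) ≤
          μ₀₁ * ((c + h) * n) * (Real.exp (-θ) - 1) :=
        mul_le_mul_of_nonpos_right (mul_le_mul_of_nonneg_left hyl h₀₁.le) hexp'
      have h2 := mul_le_mul_of_nonneg_right htilt hn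
      have h3 : μ₀₁ * x.y * (Real.exp (-θ) - 1) + μ₀₂ * ((C₂ : ℝ) - x.z) * (Real.exp θ - 1) ≤
          -(κ * n) := by linarith
      have h4 := mul_le_mul_of_nonneg_left h3 he0.le
      have h5 : 0 ≤ (μ₀₁ * c * (Real.exp θ - 1) + κ) * n * Real.exp (-(θ * h) * n) := by
        positivity
      linarith
    · have h4 : e ≤ Real.exp (-(θ * h) * n) := by
        rw [he, Real.exp_le_exp]
        have := mul_le_mul_of_nonneg_left hw hθ.le
        linarith
      have h5 := mul_le_mul_of_nonneg_left h4
        (by positivity : 0 ≤ (μ₀₁ * c * (Real.exp θ - 1) + κ) * n)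
      linarith

/-- A Lyapunov function which is at least `1` as soon as a server of level 2 is idle. -/
lemma exists_lyapunov (hp : p ∈ Set.Icc (0 : ℝ) 1) (h₀₁ : 0 < μ₀₁) (h₁₁ : 0 < μ₁₁)
    (h₀₂ : 0 < μ₀₂) {c : ℝ} (hc : 0 < c) (hover : (1 - p) * μ₀₁ * c < μ₁₁ * p * (1 - c)) :
    ∃ κ K L M η : ℝ, 0 < κ ∧ 0 ≤ K ∧ 0 ≤ M ∧ 0 < η ∧
      ∀ C₁ C₂ : ℕ, μ₀₂ * C₂ ≤ μ₀₁ * c * C₁ → ∃ V : State C₁ C₂ → ℝ,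
        (∀ x, 0 ≤ V x) ∧ (∀ x, 0 < x.z → 1 ≤ V x) ∧ (∀ x, V x ≤ L * Real.exp (M * C₁)) ∧
        ∀ x, (generator p μ₀₁ μ₁₁ μ₀₂ C₁ C₂).mulVec V x ≤
          -(κ * C₁) * V x + K * C₁ * Real.exp (-η * C₁) := by
  have hp' : 0 ≤ 1 - p := sub_nonneg.2 hp.2
  have hp0 := hp.1
  have hm : 0 < μ₁₁ * p + (1 - p) * μ₀₁ := by
    rcases hp0.eq_or_lt with h | h
    · rw [← h]
      linarith
    · positivity
  -- A shift of `c` by `3 δ` uses up three quarters of the gap in `hover`.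
  obtain ⟨δ, hδ, hδm⟩ : ∃ δ > 0, (1 - p) * μ₀₁ * (c + 3 * δ) < μ₁₁ * p * (1 - (c + 3 * δ)) := by
    refine ⟨(μ₁₁ * p * (1 - c) - (1 - p) * μ₀₁ * c) / (4 * (μ₁₁ * p + (1 - p) * μ₀₁)),
      div_pos (sub_pos.2 hover) (by positivity), ?_⟩
    set ℓ := μ₁₁ * p * (1 - c) - (1 - p) * μ₀₁ * c with hℓ
    have h1 : (μ₁₁ * p + (1 - p) * μ₀₁) * (ℓ / (4 * (μ₁₁ * p + (1 - p) * μ₀₁))) = ℓ / 4 := by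
      field_simp
    have hℓ0 : 0 < ℓ := sub_pos.2 hover
    linarith
  have hc3 : c + 3 * δ ≤ 1 := by
    by_contra! hcon
    have h1 : μ₁₁ * p * (1 - (c + 3 * δ)) ≤ 0 :=
      mul_nonpos_of_nonneg_of_nonpos (by positivity) (by linarith)
    have h2 : 0 ≤ (1 - p) * μ₀₁ * (c + 3 * δ) := by positivity
    linarith
  obtain ⟨Λ, κ₁, hΛ, -, hκ₁, htilt₁⟩ := exists_exp_tilt hδm one_pos
  have hR : 0 < μ₀₁ * c / μ₀₂ := by positivity
  -- The constraint `θ R < Λ δ` lets the `jobs` exponential dominate the `excess` one whenever `jobs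
  -- < (c + δ) C₁`.
  obtain ⟨θ, κ₂, hθ, hθΛ, hκ₂, htilt₂⟩ := exists_exp_tilt (u := μ₀₁ * c)
    (v := μ₀₁ * (c + δ / 2)) (by gcongr; linarith)
    (by positivity : 0 < Λ * δ / (μ₀₁ * c / μ₀₂))
  rw [lt_div_iff₀ hR] at hθΛ
  have heΛ : 0 ≤ Real.exp Λ - 1 := sub_nonneg.2 (Real.one_le_exp hΛ.le)
  have heθ : 0 ≤ Real.exp θ - 1 := sub_nonneg.2 (Real.one_le_exp hθ.le)
  set R := μ₀₁ * c / μ₀₂ with hRdef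
  set K₁ := μ₀₁ * (Real.exp Λ - 1) + κ₁ with hK₁
  set K₂ := μ₀₁ * c * (Real.exp θ - 1) + κ₂ with hK₂
  have hK₁0 : 0 < K₁ := by positivity
  have hK₂0 : 0 < K₂ := by positivity
  -- Half of the decay `A κ₁` of the `jobs` term absorbs the cross term of size `K₂`; the other half
  -- remains as decay.
  set A := 2 * K₂ / κ₁ with hA
  have hA0 : 0 < A := by positivity
  have hAκ : A * κ₁ = 2 * K₂ := div_mul_cancel₀ _ hκ₁.ne'
  refine ⟨min κ₂ (κ₁ / 2), K₂ + A * K₁, 1 + A, max (θ * R) (Λ * (c + 2 * δ)),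
    min (Λ * δ) (θ * (δ / 2)), lt_min hκ₂ (by positivity), by positivity,
    le_max_of_le_left (by positivity), lt_min (by positivity) (by positivity), ?_⟩
  intro C₁ C₂ hC₂
  have hn : (0 : ℝ) ≤ C₁ := Nat.cast_nonneg _
  have hC₂R : (C₂ : ℝ) ≤ R * C₁ := by
    rw [hRdef, div_mul_eq_mul_div, le_div_iff₀ h₀₂]
    linarith
  have hf₂le : ∀ x : State C₁ C₂, Real.exp (-θ * x.excess) ≤ Real.exp (θ * R * C₁) := by
    intro x
    rw [Real.exp_le_exp]
    have h1 : -x.excess ≤ R * C₁ := by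
      have : (x.z : ℝ) ≤ C₂ := Nat.cast_le.2 x.idle_le
      have : (0 : ℝ) ≤ x.ys := Nat.cast_nonneg _
      unfold State.excess
      linarith
    have := mul_le_mul_of_nonneg_left h1 hθ.le
    linarith
  refine ⟨fun x => Real.exp (-θ * x.excess) +
    A * Real.exp (-Λ * (x.jobs - (c + 2 * δ) * C₁)), fun x => by positivity, ?_, ?_, ?_⟩
  · intro x hz
    have h1 : 1 ≤ Real.exp (-θ * x.excess) := by
      refine Real.one_le_exp ?_
      rw [State.excess, x.ys_eq_zero_of_idle hz, Nat.cast_zero, zero_sub, neg_mul_neg]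
      positivity
    have h2 : 0 ≤ A * Real.exp (-Λ * (x.jobs - (c + 2 * δ) * C₁)) := by positivity
    linarith
  · intro x
    beta_reduce
    rw [add_mul 1 A, one_mul]
    refine add_le_add ((hf₂le x).trans ?_) (mul_le_mul_of_nonneg_left ?_ hA0.le)
    · gcongr
      exact le_max_left _ _
    · rw [Real.exp_le_exp]
      have h1 : Λ * (c + 2 * δ) * C₁ ≤ max (θ * R) (Λ * (c + 2 * δ)) * C₁ := by
        gcongr
        exact le_max_right _ _
      have h2 := mul_nonneg hΛ.le x.jobs_nonneg
      linarith
  · intro x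
    have hlin : (generator p μ₀₁ μ₁₁ μ₀₂ C₁ C₂).mulVec (fun x => Real.exp (-θ * x.excess) +
        A * Real.exp (-Λ * (x.jobs - (c + 2 * δ) * C₁))) x =
        (generator p μ₀₁ μ₁₁ μ₀₂ C₁ C₂).mulVec (fun x => Real.exp (-θ * x.excess)) x +
        A * (generator p μ₀₁ μ₁₁ μ₀₂ C₁ C₂).mulVec
          (fun x => Real.exp (-Λ * (x.jobs - (c + 2 * δ) * C₁))) x := by
      rw [← smul_eq_mul A, ← Pi.smul_apply, ← Matrix.mulVec_smul, ← Pi.add_apply,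
        ← Matrix.mulVec_add]
      rfl
    have hC₂' : μ₀₂ * C₂ ≤ μ₀₁ * (c + 3 * δ) * C₁ := hC₂.trans (by gcongr; linarith)
    have hd₁ := jobs_drift (a := c + 2 * δ) hp h₀₁ h₁₁ (by positivity) hc3 hΛ hκ₁.le
      htilt₁ hC₂' x
    have hd₂ := excess_drift (p := p) (μ₁₁ := μ₁₁) h₀₁ h₀₂ hc.le (by positivity) hθ hκ₂.le
      htilt₂ hC₂ x
    rw [← hK₁] at hd₁
    rw [← hK₂] at hd₂
    -- With few jobs the `excess` exponential is at most `exp (θ R C₁)`, hence below `exp (Λ δ C₁)`,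
    -- which the `jobs` exponential exceeds.
    have hcross : (if x.jobs < (c + 2 * (δ / 2)) * C₁ then Real.exp (-θ * x.excess)
        else Real.exp (-(θ * (δ / 2)) * C₁)) ≤
        Real.exp (-Λ * (x.jobs - (c + 2 * δ) * C₁)) +
          Real.exp (-min (Λ * δ) (θ * (δ / 2)) * C₁) := by
      split_ifs with hs
      · refine le_add_of_le_of_nonneg ((hf₂le x).trans ?_) (Real.exp_pos _).le
        rw [Real.exp_le_exp]
        have h1 := mul_le_mul_of_nonneg_left hs.le hΛ.le
        have h2 := mul_le_mul_of_nonneg_right hθΛ.le hn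
        linarith
      · refine le_add_of_nonneg_of_le (Real.exp_pos _).le ?_
        gcongr
        exact min_le_right _ _
    have hfar : Real.exp (-(Λ * (c + 3 * δ - (c + 2 * δ))) * C₁) ≤
        Real.exp (-min (Λ * δ) (θ * (δ / 2)) * C₁) := by
      gcongr
      refine (min_le_left _ _).trans (le_of_eq ?_)
      ring
    rw [hlin]
    beta_reduce
    set f₁ := Real.exp (-Λ * (x.jobs - (c + 2 * δ) * C₁))
    set f₂ := Real.exp (-θ * x.excess)
    set E := Real.exp (-min (Λ * δ) (θ * (δ / 2)) * C₁)
    have hf₁ : 0 < f₁ := Real.exp_pos _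
    have hf₂ : 0 < f₂ := Real.exp_pos _
    have h1 := mul_le_mul_of_nonneg_left hcross (by positivity : 0 ≤ K₂ * (C₁ : ℝ))
    have h2 := mul_le_mul_of_nonneg_left hfar (by positivity : 0 ≤ K₁ * (C₁ : ℝ))
    have h3 := mul_le_mul_of_nonneg_left (hd₁.trans (add_le_add le_rfl h2)) hA0.le
    have h4 : min κ₂ (κ₁ / 2) * (C₁ * f₂) ≤ κ₂ * (C₁ * f₂) := by
      gcongr
      exact min_le_left _ _
    have h5 : min κ₂ (κ₁ / 2) * (A * C₁ * f₁) ≤ κ₁ / 2 * (A * C₁ * f₁) := by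
      gcongr
      exact min_le_right _ _
    have h6 : A * κ₁ * (C₁ * f₁) = 2 * K₂ * (C₁ * f₁) := by rw [hAκ]
    linarith

/-- At `c = r μ₀₂ / μ₀₁` the drift condition is a rewriting of `r < r_c`. Being strict, it survives
a slight increase of `c`, which leaves room for `C₂ N / N` to differ from `r`. -/
lemma exists_level (hp : p ∈ Set.Icc (0 : ℝ) 1) (h₀₁ : 0 < μ₀₁) (h₁₁ : 0 < μ₁₁)
    (h₀₂ : 0 < μ₀₂) {r : ℝ} (hr : 0 < r) (hover : r < criticalRatio p μ₀₁ μ₁₁ μ₀₂) :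
    ∃ c, 0 < c ∧ r < μ₀₁ * c / μ₀₂ ∧ (1 - p) * μ₀₁ * c < μ₁₁ * p * (1 - c) := by
  have hp' : 0 ≤ 1 - p := sub_nonneg.2 hp.2
  have hden : 0 < p / μ₀₁ + (1 - p) / μ₁₁ := by
    rcases hp.1.eq_or_lt with h | h
    · rw [← h, zero_div, zero_add, sub_zero]
      positivity
    · positivity
  rw [criticalRatio, lt_div_iff₀ hden, lt_div_iff₀ h₀₂] at hover
  have hlt : (1 - p) * μ₀₁ * (r * μ₀₂ / μ₀₁) < μ₁₁ * p * (1 - r * μ₀₂ / μ₀₁) := by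
    have h := mul_lt_mul_of_pos_left hover h₁₁
    have h2 : μ₁₁ * (r * (p / μ₀₁ + (1 - p) / μ₁₁) * μ₀₂) =
        (1 - p) * μ₀₁ * (r * μ₀₂ / μ₀₁) + μ₁₁ * p * (r * μ₀₂ / μ₀₁) := by
      field_simp
      ring
    linarith
  have hcont : ∀ᶠ c in 𝓝[>] (r * μ₀₂ / μ₀₁), (1 - p) * μ₀₁ * c < μ₁₁ * p * (1 - c) := by
    refine nhdsWithin_le_nhds (ContinuousAt.eventually_lt ?_ ?_ hlt) <;> fun_prop
  obtain ⟨c, h1, h2⟩ := (hcont.and self_mem_nhdsWithin).exists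
  have h2 : r * μ₀₂ / μ₀₁ < c := h2
  refine ⟨c, lt_trans (by positivity) h2, ?_, h1⟩
  rw [div_lt_iff₀ h₀₁] at h2
  rw [lt_div_iff₀ h₀₂]
  linarith

end Lyapunov

end CallCenter

/-! ### Choice of `t₁` and passage to the limit. -/

theorem mainTheorem4 (p μ₀₁ μ₁₁ μ₀₂ r : ℝ) (hp : p ∈ Set.Icc (0 : ℝ) 1)
    (hμ₀₁ : 0 < μ₀₁) (hμ₁₁ : 0 < μ₁₁) (hμ₀₂ : 0 < μ₀₂) (hr : 0 < r)
    (C₂ : ℕ → ℕ) (hC₂ : Tendsto (fun N : ℕ => (C₂ N : ℝ) / N) atTop (𝓝 r))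
    (hover : r < CallCenter.criticalRatio p μ₀₁ μ₁₁ μ₀₂) :
    ∃ t₁ : ℝ≥0, 0 < t₁ ∧
      ∀ x₀ ∈ Set.Icc (0 : ℝ) 1 ×ˢ Set.Icc (0 : ℝ) 1 ×ˢ Set.Icc (0 : ℝ) r,
      ∀ (Ω : ℕ → Type*) [∀ N, MeasurableSpace (Ω N)]
        (P : ∀ N, Measure (Ω N)) [∀ N, IsProbabilityMeasure (P N)]
        (X : ∀ N, ℝ≥0 → Ω N → CallCenter.State N (C₂ N)),
        (∀ N, CallCenter.IsMarkovJumpProcess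
          (CallCenter.generator p μ₀₁ μ₁₁ μ₀₂ N (C₂ N)) (P N) (X N)) →
        (∀ ε > 0, Tendsto (fun N => P N {ω | ε ≤ dist ((X N 0 ω).scaled N) x₀})
          atTop (𝓝 0)) →
        ∀ T : ℝ≥0, t₁ ≤ T →
          Tendsto (fun N => P N {ω | ∀ t ∈ Set.Icc t₁ T, (X N t ω).z = 0})
            atTop (𝓝 1) := by
  obtain ⟨c, hc, hrc, hcm⟩ := CallCenter.exists_level hp hμ₀₁ hμ₁₁ hμ₀₂ hr hover
  obtain ⟨κ, K, L, M, η, hκ, hK, hM, hη, hlyap⟩ :=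
    CallCenter.exists_lyapunov hp hμ₀₁ hμ₁₁ hμ₀₂ hc hcm
  -- At this time the decay `exp (-κ N t₁)` beats the worst initial value `L exp (M N)` by a factor
  -- `exp (-N)`.
  have ht₁ : 0 < (M + 1) / κ := by positivity
  refine ⟨⟨(M + 1) / κ, ht₁.le⟩, ht₁, ?_⟩
  intro x₀ _ Ω _ P _ X hX _ T hT
  set t₁ : ℝ≥0 := ⟨(M + 1) / κ, ht₁.le⟩ with ht₁def
  have hκt : κ * (t₁ : ℝ) = M + 1 := mul_div_cancel₀ (M + 1) hκ.ne'
  have hbound : ∀ᶠ N : ℕ in atTop,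
      1 - ENNReal.ofReal (L * Real.exp (-1 * N) + K / κ * Real.exp (-η * N) +
        ((T : ℝ) - t₁) * K * (N * Real.exp (-η * N))) ≤
      P N {ω | ∀ t ∈ Set.Icc t₁ T, (X N t ω).z = 0} := by
    filter_upwards [hC₂.eventually (gt_mem_nhds hrc), eventually_gt_atTop 0] with N hN hN0
    have hn : (0 : ℝ) < N := Nat.cast_pos.2 hN0
    have hcap : μ₀₂ * C₂ N ≤ μ₀₁ * c * N := by
      rw [div_lt_div_iff₀ hn hμ₀₂] at hN
      linarith
    obtain ⟨V, hV₀, hVB, hVL, hdrift⟩ := hlyap N (C₂ N) hcap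
    have hQ := CallCenter.isQMatrix_generator (C₁ := N) (C₂ := C₂ N) hp hμ₀₁.le hμ₁₁.le hμ₀₂.le
    have ha : 0 < κ * (N : ℝ) := by positivity
    have hd : 0 ≤ K * N * Real.exp (-η * N) := by positivity
    have h := (hX N).one_sub_le_measure_forall_notMem (B := {x | 0 < x.z}) hd hT hV₀ hVB
      (fun t ht x => hQ.exp_mulVec_le_add ha hd hV₀ hdrift ht x)
      (c := L * Real.exp (-1 * N) + K / κ * Real.exp (-η * N)) fun x => by
        refine (hQ.exp_mulVec_le ha hdrift t₁.coe_nonneg x).trans (add_le_add ?_ ?_)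
        · have he : Real.exp (-(κ * N) * t₁) * Real.exp (M * N) = Real.exp (-1 * N) := by
            rw [← Real.exp_add]
            congr 1
            linear_combination -(N : ℝ) * hκt
          calc _ ≤ Real.exp (-(κ * N) * t₁) * (L * Real.exp (M * N)) := by
                gcongr
                exact hVL x
            _ = L * Real.exp (-1 * N) := by rw [← he]; ring
        · have hdiv : K * N * Real.exp (-η * N) / (κ * N) = K / κ * Real.exp (-η * N) := by
            field_simp
          rw [hdiv]
          refine mul_le_of_le_one_left (by positivity) ?_
          have := Real.exp_pos (-(κ * N) * t₁)
          linarith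
    refine le_trans (le_of_eq ?_) (h.trans (le_of_eq ?_))
    · congr 2
      ring
    · congr 1
      ext ω
      simp
  have hlin : ∀ b : ℝ, 0 < b → Tendsto (fun N : ℕ => Real.exp (-b * N)) atTop (𝓝 0) := by
    intro b hb
    refine Real.tendsto_exp_atBot.comp ?_
    exact tendsto_natCast_atTop_atTop.const_mul_atTop_of_neg (neg_lt_zero.2 hb)
  have hmul : Tendsto (fun N : ℕ => (N : ℝ) * Real.exp (-η * N)) atTop (𝓝 0) := by
    have h := (Real.tendsto_pow_mul_exp_neg_atTop_nhds_zero 1).comp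
      (tendsto_natCast_atTop_atTop.const_mul_atTop hη : Tendsto (fun N : ℕ => η * (N : ℝ)) _ _)
    have h2 := h.const_mul η⁻¹
    rw [mul_zero] at h2
    refine h2.congr fun N => ?_
    simp only [Function.comp_apply, pow_one]
    rw [← mul_assoc, inv_mul_cancel_left₀ hη.ne', neg_mul]
  have hlim : Tendsto (fun N : ℕ => L * Real.exp (-1 * N) + K / κ * Real.exp (-η * N) +
      ((T : ℝ) - t₁) * K * (N * Real.exp (-η * N))) atTop (𝓝 0) := by
    simpa using (((hlin 1 one_pos).const_mul L).add ((hlin η hη).const_mul (K / κ))).add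
      (hmul.const_mul (((T : ℝ) - t₁) * K))
  have hlim' := ENNReal.Tendsto.sub (tendsto_const_nhds (x := (1 : ENNReal)) (f := atTop))
    (ENNReal.tendsto_ofReal hlim) (Or.inl ENNReal.one_ne_top)
  rw [ENNReal.ofReal_zero, tsub_zero] at hlim'
  exact tendsto_of_tendsto_of_tendsto_of_le_of_le' hlim' tendsto_const_nhds hbound
    (Eventually.of_forall fun N => prob_le_one)
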